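/- There is an absolute constant $A$ such that for every exponent $c\in\mathbb N$ there are a constant $B$ (depending only on $c$) and a randomized algorithm which, given $n$, $k$ and query access to a monotone function $f:\{0,1\}^n\to\{0,1\}$ with certificate complexity $C(f)\le k$, always makes at most $B\,k^7\log n$ queries to $f$ and, with probability at least $1-n^{-c}$ over its internal randomness, returns a set $S\subseteq[n]$ with $|S|\le A\,k^3$ and a bit $b\in\{0,1\}$ such that $S$ is a certificate for $f$'s value on the input $(b,\dots,b)$; equivalently, $f$ becomes constant when all coordinates in $S$ are restricted to $b$. Here a set $S\subseteq[n]$ is a certificate for $f$'s value on $x$ if $f(y)=f(x)$ for all $y$ that agree with $x$ on $S$; $C(f,x)$ is the least size of such a set, and $C(f)=\max_{x}C(f,x)$. A randomized query algorithm is a probability distribution over deterministic adaptive query algorithms, and its only cost is the number of queries. -/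

import Mathlib

namespace MonotoneCert

/-- `S` is a certificate for `f`'s value on `x`: every `y` that agrees with `x` on `S`
satisfies `f y = f x`. -/
def IsCertificate {n : ℕ} (f : (Fin n → Bool) → Bool) (x : Fin n → Bool)
    (S : Finset (Fin n)) : Prop :=
  ∀ y : Fin n → Bool, (∀ i ∈ S, y i = x i) → f y = f x

/-- `C(f, x)`: the least size of a certificate for `f`'s value on `x`. The set below is never
empty, since the set of all coordinates is a certificate (`exists_certificate`). -/
noncomputable def certComplexityAt {n : ℕ} (f : (Fin n → Bool) → Bool)
    (x : Fin n → Bool) : ℕ :=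
  sInf {m : ℕ | ∃ S : Finset (Fin n), IsCertificate f x S ∧ S.card = m}

theorem exists_certificate {n : ℕ} (f : (Fin n → Bool) → Bool) (x : Fin n → Bool) :
    ∃ S : Finset (Fin n), IsCertificate f x S :=
  ⟨Finset.univ, fun _ hy => congrArg f (funext fun i => hy i (Finset.mem_univ i))⟩

/-- `C(f)`: the maximum of `C(f, x)` over all inputs `x`. -/
noncomputable def certComplexity {n : ℕ} (f : (Fin n → Bool) → Bool) : ℕ :=
  Finset.univ.sup fun x : Fin n → Bool => certComplexityAt f x

/-- A deterministic adaptive query algorithm with black-box access to a function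
`f : {0,1}ⁿ → {0,1}`: it either stops with an output, or queries `f` at a point `x` and continues
depending on the answer `f x`. -/
inductive QueryAlg (n : ℕ) (α : Type) : Type
  | output (a : α) : QueryAlg n α
  | query (x : Fin n → Bool) (next : Bool → QueryAlg n α) : QueryAlg n α

/-- The output of a deterministic query algorithm when it is run on `f`. -/
def QueryAlg.run {n : ℕ} {α : Type} (f : (Fin n → Bool) → Bool) : QueryAlg n α → α
  | .output a => a
  | .query x next => (next (f x)).run f

/-- The number of queries a deterministic query algorithm makes when it is run on `f`. -/
def QueryAlg.numQueries {n : ℕ} {α : Type} (f : (Fin n → Bool) → Bool) : QueryAlg n α → ℕ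
  | .output _ => 0
  | .query x next => (next (f x)).numQueries f + 1

/-- A randomized query algorithm: a probability distribution over deterministic ones. -/
abbrev RandQueryAlg (n : ℕ) (α : Type) : Type := PMF (QueryAlg n α)

/-- The probability, over the randomness of the algorithm, that its output on `f` satisfies `P`. -/
noncomputable def RandQueryAlg.prob {n : ℕ} {α : Type} (R : RandQueryAlg n α)
    (f : (Fin n → Bool) → Bool) (P : α → Prop) : ℝ :=
  (R.toOuterMeasure {t : QueryAlg n α | P (t.run f)}).toReal

/-- The algorithm makes at most `q` queries on `f`, whatever its random choices are. -/
def RandQueryAlg.MakesAtMost {n : ℕ} {α : Type} (R : RandQueryAlg n α)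
    (f : (Fin n → Bool) → Bool) (q : ℝ) : Prop :=
  ∀ t ∈ R.support, (t.numQueries f : ℝ) ≤ q

end MonotoneCert

namespace MonotoneCert

/-! A deterministic algorithm with O(k log n) queries suffices. If `f` rejects the all-ones input,
monotonicity makes it constant and ∅ is a certificate. Otherwise a minterm is built from the top
down: while `T` alone is rejected, binary search over initial segments finds the next coordinate to
add (`IsPartialMinterm.insert`). Every element of `T` stays essential, so it lies in each
certificate at one common input; hence `T` never exceeds `k` elements (`IsPartialMinterm.card_le`)
and the search ends. By monotonicity an accepted set certifies the all-ones input. -/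

/-- A certificate complexity bound yields a small certificate at every point. -/
theorem exists_certificate_card_le {n k : ℕ} {f : (Fin n → Bool) → Bool}
    (hk : certComplexity f ≤ k) (x : Fin n → Bool) :
    ∃ S : Finset (Fin n), IsCertificate f x S ∧ S.card ≤ k := by
  have hne : {m : ℕ | ∃ S : Finset (Fin n), IsCertificate f x S ∧ S.card = m}.Nonempty := by
    obtain ⟨S, hS⟩ := exists_certificate f x
    exact ⟨S.card, S, hS, rfl⟩
  obtain ⟨S, hS, hcard⟩ := Nat.sInf_mem hne
  refine ⟨S, hS, ?_⟩
  rw [hcard]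
  exact (Finset.le_sup (f := fun x => certComplexityAt f x) (Finset.mem_univ x)).trans hk

/-- The indicator vector of a set of coordinates. -/
def indicator {n : ℕ} (T : Finset (Fin n)) : Fin n → Bool := fun i => decide (i ∈ T)

theorem indicator_mono {n : ℕ} {S T : Finset (Fin n)} (h : S ⊆ T) :
    indicator S ≤ indicator T := by
  intro i
  by_cases hi : i ∈ S
  · simp [indicator, hi, h hi]
  · simp [indicator, hi]

/-- The set of the first `j` coordinates. -/
def initialSet (n j : ℕ) : Finset (Fin n) := Finset.univ.filter fun i => i.val < j

@[simp] theorem mem_initialSet {n j : ℕ} {i : Fin n} : i ∈ initialSet n j ↔ i.val < j := by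
  simp [initialSet]

theorem eq_false_of_le {n : ℕ} {f : (Fin n → Bool) → Bool} (hf : Monotone f)
    {x y : Fin n → Bool} (hxy : x ≤ y) (hy : f y = false) : f x = false := by
  have := hf hxy
  rw [hy] at this
  exact le_bot_iff.mp this

theorem eq_true_of_le {n : ℕ} {f : (Fin n → Bool) → Bool} (hf : Monotone f)
    {x y : Fin n → Bool} (hxy : x ≤ y) (hx : f x = true) : f y = true := by
  have := hf hxy
  rw [hx] at this
  exact top_le_iff.mp this

/-! ### Binary search -/

/-- Binary search along the sequence of points `q`, with `d` queries, for a place in `(lo, hi]`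
where the value changes from `false` to `true`; the run goes on with `next` applied to it. -/
def binarySearch {n : ℕ} {α : Type} (q : ℕ → Fin n → Bool) (next : ℕ → QueryAlg n α) :
    ℕ → ℕ → ℕ → QueryAlg n α
  | 0, _, hi => next hi
  | d + 1, lo, hi => .query (q ((lo + hi) / 2)) fun b =>
      bif b then binarySearch q next d lo ((lo + hi) / 2)
      else binarySearch q next d ((lo + hi) / 2) hi

theorem binarySearch_spec {n : ℕ} {α : Type} (f : (Fin n → Bool) → Bool) (q : ℕ → Fin n → Bool)
    (next : ℕ → QueryAlg n α) (d lo hi : ℕ) (hlt : lo < hi) (hd : hi ≤ lo + 2 ^ d)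
    (hlo : f (q lo) = false) (hhi : f (q hi) = true) :
    ∃ j, j < hi ∧ f (q j) = false ∧ f (q (j + 1)) = true ∧
      (binarySearch q next d lo hi).run f = (next (j + 1)).run f ∧
      (binarySearch q next d lo hi).numQueries f = (next (j + 1)).numQueries f + d := by
  induction d generalizing lo hi with
  | zero =>
    obtain rfl : hi = lo + 1 := by simp at hd; omega
    exact ⟨lo, hlt, hlo, hhi, rfl, rfl⟩
  | succ d ih =>
    rw [pow_succ] at hd
    cases hm : f (q ((lo + hi) / 2)) with
    | true =>
      -- If `hi = lo + 1`, the midpoint is `lo` itself, which is rejected.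
      have hne : (lo + hi) / 2 ≠ lo := fun h => by simp [h, hlo] at hm
      obtain ⟨j, h1, h2, h3, h4, h5⟩ := ih lo ((lo + hi) / 2) (by omega) (by omega) hlo hm
      refine ⟨j, by omega, h2, h3, ?_, ?_⟩
      · simp [binarySearch, QueryAlg.run, hm, h4]
      · simp [binarySearch, QueryAlg.numQueries, hm, h5, add_assoc]
    | false =>
      obtain ⟨j, h1, h2, h3, h4, h5⟩ := ih ((lo + hi) / 2) hi (by omega) (by omega) hm hhi
      refine ⟨j, h1, h2, h3, ?_, ?_⟩
      · simp [binarySearch, QueryAlg.run, hm, h4]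
      · simp [binarySearch, QueryAlg.numQueries, hm, h5, add_assoc]

/-! ### Growing a minterm -/

/-- `T` is the upper part of a minterm of `f` whose other elements are below `hi`: the set
`T ∪ {i | i < hi}` is accepted, and no element of `T` can be removed from it. -/
structure IsPartialMinterm {n : ℕ} (f : (Fin n → Bool) → Bool) (T : Finset (Fin n))
    (hi : ℕ) : Prop where
  accepted : f (indicator (T ∪ initialSet n hi)) = true
  essential : ∀ i ∈ T, f (indicator (T.erase i ∪ initialSet n hi)) = false

/-- Every certificate at the indicator vector contains all essential coordinates. -/
theorem IsPartialMinterm.card_le {n k hi : ℕ} {f : (Fin n → Bool) → Bool} {T : Finset (Fin n)}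
    (h : IsPartialMinterm f T hi) (hk : certComplexity f ≤ k) : T.card ≤ k := by
  obtain ⟨S, hS, hcard⟩ := exists_certificate_card_le hk (indicator (T ∪ initialSet n hi))
  refine (Finset.card_le_card fun i hi' => ?_).trans hcard
  by_contra hiS
  have h1 := hS (indicator (T.erase i ∪ initialSet n hi)) fun l hl => by
    have hli : l ≠ i := fun e => hiS (e ▸ hl)
    simp [indicator, hli]
  rw [h.essential i hi', h.accepted] at h1
  exact Bool.false_ne_true h1

/-- Dropping `j` again leaves a subset of the rejected `T ∪ [0, j)`; dropping an older element
leaves a subset of a set already rejected, since `j < hi`. -/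
theorem IsPartialMinterm.insert {n hi j : ℕ} {f : (Fin n → Bool) → Bool} {T : Finset (Fin n)}
    (hf : Monotone f) (h : IsPartialMinterm f T hi) (hj : j < n) (hjhi : j < hi)
    (hlo : f (indicator (T ∪ initialSet n j)) = false)
    (hup : f (indicator (T ∪ initialSet n (j + 1))) = true) :
    (⟨j, hj⟩ : Fin n) ∉ T ∧ IsPartialMinterm f (insert ⟨j, hj⟩ T) j := by
  have hset : T ∪ initialSet n (j + 1) = Insert.insert ⟨j, hj⟩ T ∪ initialSet n j := by
    ext i
    simp only [Finset.mem_union, Finset.mem_insert, mem_initialSet, Fin.ext_iff]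
    grind
  refine ⟨fun hmem => ?_, by rwa [← hset], fun i hi' => ?_⟩
  · rw [hset, Finset.insert_eq_of_mem hmem, hlo] at hup
    exact Bool.false_ne_true hup
  · by_cases hij : i = ⟨j, hj⟩
    · refine eq_false_of_le hf (indicator_mono ?_) hlo
      subst hij
      exact Finset.union_subset_union_left (Finset.erase_insert_subset _ _)
    · refine eq_false_of_le hf (indicator_mono ?_)
        (h.essential i ((Finset.mem_insert.mp hi').resolve_left hij))
      intro l
      simp only [Finset.mem_union, Finset.mem_insert, Finset.mem_erase, mem_initialSet,
        Fin.ext_iff]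
      grind

/-- Complete the partial minterm `T` with at most `s` further elements below `hi`, each found by
a binary search with `d` queries. -/
def findMinterm {n : ℕ} (d : ℕ) : ℕ → Finset (Fin n) → ℕ → QueryAlg n (Finset (Fin n) × Bool)
  | 0, T, _ => .output (T, true)
  | s + 1, T, hi => .query (indicator T) fun b =>
      bif b then .output (T, true)
      else binarySearch (fun j => indicator (T ∪ initialSet n j))
        -- The filter is `{j - 1}`, written without a proof of `j - 1 < n`.
        (fun j => findMinterm d s (T ∪ Finset.univ.filter fun i => i.val + 1 = j) (j - 1)) d 0 hi

/-- Since `T.card ≤ k`, the invariant `hs` keeps the fuel `s` from running out. A round costs one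
test of `T` and `d` search queries. -/
theorem numQueries_findMinterm_le_and_run {n k d : ℕ} {f : (Fin n → Bool) → Bool}
    (hf : Monotone f) (hk : certComplexity f ≤ k) (hd : n ≤ 2 ^ d) (s : ℕ) (T : Finset (Fin n))
    (hi : ℕ) (hin : hi ≤ n) (hT : IsPartialMinterm f T hi) (hs : k + 1 ≤ T.card + s) :
    (findMinterm d s T hi).numQueries f ≤ s * (d + 1) ∧
    ∃ S : Finset (Fin n), (findMinterm d s T hi).run f = (S, true) ∧ S.card ≤ k ∧
      f (indicator S) = true := by
  induction s generalizing T hi with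
  | zero => have := hT.card_le hk; omega
  | succ s ih =>
    cases hb : f (indicator T) with
    | true =>
      refine ⟨?_, T, ?_, hT.card_le hk, hb⟩
      · simp [findMinterm, QueryAlg.numQueries, hb]
        nlinarith
      · simp [findMinterm, QueryAlg.run, hb]
    | false =>
      have h0 : T ∪ initialSet n 0 = T := by ext; simp
      have hpos : 0 < hi := by
        rcases Nat.eq_zero_or_pos hi with rfl | h
        · have := hT.accepted
          rw [h0, hb] at this
          exact absurd this Bool.false_ne_true
        · exact h
      obtain ⟨j, h1, h2, h3, h4, h5⟩ := binarySearch_spec f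
        (fun j => indicator (T ∪ initialSet n j))
        (fun j => findMinterm d s (T ∪ Finset.univ.filter fun i => i.val + 1 = j) (j - 1))
        d 0 hi hpos (by omega) (by simpa only [h0] using hb) hT.accepted
      have hj : j < n := by omega
      obtain ⟨hmem, hins⟩ := hT.insert hf hj h1 h2 h3
      have hset : (T ∪ Finset.univ.filter fun i : Fin n => i.val + 1 = j + 1) =
          insert ⟨j, hj⟩ T := by
        ext i
        simp [Fin.ext_iff, or_comm]
      rw [hset] at h4 h5
      rw [Nat.add_sub_cancel] at h4 h5
      obtain ⟨hq, S, hrun, hS⟩ := ih (insert ⟨j, hj⟩ T) j hj.le hins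
        (by rw [Finset.card_insert_of_notMem hmem]; omega)
      refine ⟨?_, S, ?_, hS⟩
      · simp only [findMinterm, QueryAlg.numQueries, hb, cond_false, h5]
        linarith
      · simp only [findMinterm, QueryAlg.run, hb, cond_false, h4, hrun]

theorem isCertificate_of_indicator {n : ℕ} {f : (Fin n → Bool) → Bool} (hf : Monotone f)
    {S : Finset (Fin n)} (hS : f (indicator S) = true) :
    IsCertificate f (fun _ => true) S := by
  have key : ∀ y : Fin n → Bool, (∀ i ∈ S, y i = true) → f y = true := fun y hy =>
    eq_true_of_le hf (fun i => by
      by_cases hi : i ∈ S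
      · simp [hy i hi]
      · simp [indicator, hi]) hS
  intro y hy
  rw [key y hy, key _ fun _ _ => rfl]

/-! ### The algorithm and its query bound -/

/-- The certification algorithm. Without coordinates, or with `k = 0`, the empty set is a
certificate, and for a single coordinate the full set is, so that no query is made. -/
def certify (n k : ℕ) : QueryAlg n (Finset (Fin n) × Bool) :=
  if k = 0 then .output (∅, true)
  else if n ≤ 1 then .output (Finset.univ, true)
  else .query (fun _ => true) fun b =>
    bif b then findMinterm (Nat.log 2 n + 1) (k + 1) ∅ n else .output (∅, true)

theorem run_certify {n k : ℕ} {f : (Fin n → Bool) → Bool} (hf : Monotone f)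
    (hk : certComplexity f ≤ k) :
    IsCertificate f (fun _ => ((certify n k).run f).2) ((certify n k).run f).1 ∧
      ((certify n k).run f).1.card ≤ k ∧
      ((certify n k).numQueries f : ℝ) ≤ 14 * (k : ℝ) * Real.log n := by
  rcases Nat.eq_zero_or_pos k with rfl | hk0
  · obtain ⟨S, hS, hcard⟩ := exists_certificate_card_le hk (fun _ => true)
    obtain rfl : S = ∅ := by simpa using hcard
    simpa [certify, QueryAlg.run, QueryAlg.numQueries] using hS
  -- Here `Real.log n = 0`, so no query is affordable.
  by_cases hn : n ≤ 1
  · refine ⟨?_, ?_, ?_⟩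
    · simp only [certify, hk0.ne', hn, if_true, if_false, QueryAlg.run]
      exact fun y hy => congrArg f (funext fun i => hy i (Finset.mem_univ i))
    · simp only [certify, hk0.ne', hn, if_true, if_false, QueryAlg.run, Finset.card_fin]
      omega
    · simp only [certify, hk0.ne', hn, if_true, if_false, QueryAlg.numQueries, Nat.cast_zero]
      have := Real.log_natCast_nonneg n
      positivity
  have hL : 1 ≤ Nat.log 2 n := Nat.log_pos one_lt_two (by omega)
  -- This uses ln 2 > 1/2.
  have hlog : (Nat.log 2 n : ℝ) ≤ 2 * Real.log n := by
    have h1 : ((2 : ℝ) ^ Nat.log 2 n) ≤ n := by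
      exact_mod_cast Nat.pow_log_le_self 2 (by omega : n ≠ 0)
    have h2 := Real.log_le_log (by positivity) h1
    rw [Real.log_pow] at h2
    have h3 := Real.log_two_gt_d9
    have h4 : (0 : ℝ) ≤ Nat.log 2 n := Nat.cast_nonneg _
    nlinarith
  -- With L the binary logarithm and k, L ≥ 1: k + 1 ≤ 2k and L + 2 ≤ 3L, giving 1 + 6kL ≤ 7kL.
  have hbound : 1 + (k + 1) * (Nat.log 2 n + 1 + 1) ≤ 7 * k * Nat.log 2 n := by
    obtain ⟨a, rfl⟩ := Nat.exists_eq_add_of_le hk0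
    obtain ⟨b, hb⟩ := Nat.exists_eq_add_of_le hL
    rw [hb]
    ring_nf
    nlinarith [Nat.zero_le (a * b)]
  have hcount : ∀ m : ℕ, m ≤ 1 + (k + 1) * (Nat.log 2 n + 1 + 1) →
      (m : ℝ) ≤ 14 * (k : ℝ) * Real.log n := fun m hm => by
    have h1 : (m : ℝ) ≤ 7 * k * Nat.log 2 n := by exact_mod_cast hm.trans hbound
    have h2 : (7 * k : ℝ) * Nat.log 2 n ≤ 7 * k * (2 * Real.log n) := by gcongr
    linarith
  cases hb : f (fun _ => true) with
  | true =>
    have hT : IsPartialMinterm f ∅ n := by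
      refine ⟨?_, by simp⟩
      have : indicator (∅ ∪ initialSet n n) = fun _ => true := by
        funext i
        simp [indicator]
      rw [this, hb]
    obtain ⟨hq, S, hrun, hcard, hS⟩ := numQueries_findMinterm_le_and_run hf hk
      (Nat.lt_pow_succ_log_self one_lt_two n).le (k + 1) ∅ n le_rfl hT (by simp)
    have hr : (certify n k).run f = (S, true) := by
      simp only [certify, hk0.ne', hn, if_false, QueryAlg.run, hb, cond_true]
      exact hrun
    rw [hr]
    refine ⟨isCertificate_of_indicator hf hS, hcard, hcount _ ?_⟩
    simp only [certify, hk0.ne', hn, if_false, QueryAlg.numQueries, hb, cond_true]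
    rw [add_comm]
    exact Nat.add_le_add_left hq 1
  | false =>
    have hr : (certify n k).run f = (∅, true) := by
      simp only [certify, hk0.ne', hn, if_false, QueryAlg.run, hb, cond_false]
    rw [hr]
    refine ⟨fun y _ => ?_, by simp, hcount _ ?_⟩
    · rw [hb]
      exact eq_false_of_le hf (fun i => Bool.le_true _) hb
    · simp [certify, hk0.ne', hn, QueryAlg.numQueries, hb]

theorem prob_pure_of_run {n : ℕ} {α : Type} {t : QueryAlg n α} {f : (Fin n → Bool) → Bool}
    {P : α → Prop} (h : P (t.run f)) : RandQueryAlg.prob (PMF.pure t) f P = 1 := by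
  rw [RandQueryAlg.prob, PMF.toOuterMeasure_pure_apply, if_pos (by exact h), ENNReal.toReal_one]

end MonotoneCert
/-- An output `(S, b)` names the set `S` and the input `(b, …, b)`: it is correct when `S` is a
certificate for `f`'s value on that input, that is, when `f` with all coordinates in `S`
restricted to `b` is constant. -/
theorem mainTheorem2 :
    ∃ A : ℕ, ∀ c : ℕ, ∃ B : ℝ,
      ∃ alg : ∀ n : ℕ, ℕ → MonotoneCert.RandQueryAlg n (Finset (Fin n) × Bool),
        ∀ (n k : ℕ) (f : (Fin n → Bool) → Bool),
          Monotone f → MonotoneCert.certComplexity f ≤ k →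
            (alg n k).MakesAtMost f (B * (k : ℝ) ^ 7 * Real.log (n : ℝ)) ∧
            1 - 1 / (n : ℝ) ^ c ≤
              (alg n k).prob f (fun out : Finset (Fin n) × Bool =>
                MonotoneCert.IsCertificate f (fun _ : Fin n => out.2) out.1 ∧
                  out.1.card ≤ A * k ^ 3) := by
  -- Success is certain, so `B` need not depend on `c`; 14 is 7 · 2 from `run_certify`.
  refine ⟨1, fun c => ⟨14, fun n k => PMF.pure (MonotoneCert.certify n k),
    fun n k f hf hk => ?_⟩⟩
  obtain ⟨hcert, hcard, hq⟩ := MonotoneCert.run_certify hf hk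
  constructor
  · intro t ht
    rw [PMF.support_pure, Set.mem_singleton_iff] at ht
    subst ht
    have hk7 : (k : ℝ) ≤ (k : ℝ) ^ 7 := by exact_mod_cast Nat.le_self_pow (by norm_num) k
    have := Real.log_natCast_nonneg n
    exact hq.trans (by gcongr)
  · rw [MonotoneCert.prob_pure_of_run]
    · exact sub_le_self 1 (by positivity)
    · refine ⟨hcert, ?_⟩
      rw [one_mul]
      exact hcard.trans (Nat.le_self_pow (by norm_num) k)
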